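/- Let $\alpha(t)=\sum_{n\ge 0}\alpha_n t^n$ have real coefficients with $\sum_n|\alpha_n|<\infty$, and suppose that $\alpha$ has no zeros in the open unit disc $\mathbb D\subset\mathbb C$. Put $k(t)=1/\alpha(t)=\sum_{n\ge 0}k_n t^n$ for $t\in\mathbb D$, and suppose that $\alpha_0=k_0=1$ and $k_n>0$ for all $n\ge 1$. For a complex Hilbert space $\mathfrak D$, let $\mathcal H_k\otimes\mathfrak D$ be the Hilbert space of power series $f(t)=\sum_{n\ge 0}f_nt^n$ with coefficients $f_n\in\mathfrak D$ and $\|f\|^2=\sum_n\|f_n\|^2k_n<\infty$, and let $B_k\otimes I_{\mathfrak D}$ be the backward shift $f(t)\mapsto (f(t)-f(0))/t$ on it. Let $\mathcal R_k$ be the Hilbert space of power series $f(z)=\sum_{n\ge 0}f_nz^n$ with $f_n\in\mathbb C$ and $\|f\|^2=\sum_n|f_n|^2/k_n<\infty$. Assume that $\mathcal R_k$ is a Banach algebra with respect to the multiplication of power series, that is, $fg\in\mathcal R_k$ and $\|fg\|\le C\|f\|\,\|g\|$ for all $f,g\in\mathcal R_k$, with a constant $C$ (so that, in particular, $B_k\otimes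 I_{\mathfrak D}$ is bounded). Assume also that $$\lim_{n\to\infty}\Big(\inf_{j\ge 0}\frac{k_j}{k_{n+j}}\Big)^{1/n}=\lim_{n\to\infty}k_n^{1/n}=1 .$$ **Theorem.** Let $\mathfrak D$ be finite dimensional and let $T$ be a bounded operator on a complex Hilbert space $H$ that is similar to a part of $B_k\otimes I_{\mathfrak D}$: there are a closed subspace $L\subset\mathcal H_k\otimes\mathfrak D$, invariant under $B_k\otimes I_{\mathfrak D}$, and a bounded invertible operator $S:H\to L$ with $ST=\big((B_k\otimes I_{\mathfrak D})|_L\big)S$. If the spectrum $\sigma(T)$ does not contain $\mathbb D$, then there is a non-zero function $f\in\mathcal R_k$ such that $f(z)=0$ for every $z\in\sigma(T)\cap\mathbb D$. -/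

import Mathlib

open Filter Topology

/-- Positive weights `w 0, w 1, w 2, …`. -/
abbrev PosWeight : Type := ℕ → {x : ℝ // 0 < x}

/-- The coefficient sequences `f₀, f₁, …` in `E` with `∑ ‖fₙ‖² wₙ < ∞`. -/
def weightedSubmodule (w : PosWeight) (E : Type*) [NormedAddCommGroup E]
    [InnerProductSpace ℂ E] : Submodule ℂ (ℕ → E) where
  carrier := {f | Summable fun n => ‖f n‖ ^ 2 * (w n : ℝ)}
  zero_mem' := by simp [summable_zero]
  add_mem' := by
    intro f g hf hg
    refine Summable.of_nonneg_of_le (fun n => mul_nonneg (sq_nonneg _) (w n).2.le) (fun n => ?_)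
      ((Summable.add hf hg).mul_left 2)
    have h1 : ‖f n + g n‖ ^ 2 ≤ 2 * (‖f n‖ ^ 2 + ‖g n‖ ^ 2) := by
      have := norm_add_le (f n) (g n)
      nlinarith [sq_nonneg (‖f n‖ - ‖g n‖), norm_nonneg (f n + g n)]
    have := mul_le_mul_of_nonneg_right h1 (w n).2.le
    simp only [Pi.add_apply]
    linarith
  smul_mem' := by
    intro c f hf
    have := Summable.mul_left (‖c‖ ^ 2) hf
    refine this.congr (fun n => ?_)
    simp only [Pi.smul_apply, norm_smul]
    ring

/-- The weighted Hilbert space of `E`-valued power series `f(t) = ∑ fₙ tⁿ` with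
`‖f‖² = ∑ ‖fₙ‖² wₙ < ∞`, a series being given by its coefficients. For `E = ℂ` this is `ℋ_w`; in
general it is the standard realization of the Hilbert space tensor product `ℋ_w ⊗ E`. -/
def WeightedSeries (w : PosWeight) (E : Type*) [NormedAddCommGroup E]
    [InnerProductSpace ℂ E] : Type _ :=
  weightedSubmodule w E

namespace WeightedSeries

variable {w : PosWeight} {E : Type*} [NormedAddCommGroup E] [InnerProductSpace ℂ E]

instance instAddCommGroup : AddCommGroup (WeightedSeries w E) :=
  inferInstanceAs (AddCommGroup (weightedSubmodule w E))

instance instModule : Module ℂ (WeightedSeries w E) :=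
  inferInstanceAs (Module ℂ (weightedSubmodule w E))

/-- `f n` is the `n`-th coefficient of the power series `f`. -/
instance instCoeFun : CoeFun (WeightedSeries w E) (fun _ => ℕ → E) :=
  ⟨fun f => Subtype.val f⟩

theorem ext {f g : WeightedSeries w E} (h : ∀ n, f n = g n) : f = g :=
  Subtype.ext (funext h)

theorem summable (f : WeightedSeries w E) : Summable fun n => ‖f n‖ ^ 2 * (w n : ℝ) := f.2

/-- The power series with a given sequence of coefficients. -/
def mk (f : ℕ → E) (hf : Summable fun n => ‖f n‖ ^ 2 * (w n : ℝ)) : WeightedSeries w E :=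
  ⟨f, hf⟩

theorem summable_inner (f g : WeightedSeries w E) :
    Summable fun n => ((w n : ℝ) : ℂ) * inner ℂ (f n) (g n) := by
  refine Summable.of_norm_bounded (f.summable.add g.summable) (fun n => ?_)
  have h0 := (w n).2
  rw [norm_mul, Complex.norm_real, Real.norm_eq_abs, abs_of_pos h0]
  have h1 := norm_inner_le_norm (𝕜 := ℂ) (f n) (g n)
  have h2 : ‖inner ℂ (f n) (g n)‖ ≤ ‖f n‖ ^ 2 + ‖g n‖ ^ 2 := by
    nlinarith [sq_nonneg (‖f n‖ - ‖g n‖), sq_nonneg (‖f n‖), sq_nonneg (‖g n‖)]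
  nlinarith

theorem inner_self_term (f : WeightedSeries w E) (n : ℕ) :
    ((w n : ℝ) : ℂ) * inner ℂ (f n) (f n) = ((‖f n‖ ^ 2 * (w n : ℝ) : ℝ) : ℂ) := by
  rw [inner_self_eq_norm_sq_to_K]
  push_cast
  exact mul_comm _ _

/-- The inner product `⟨f, g⟩ = ∑ wₙ ⟨fₙ, gₙ⟩`, antilinear in the first argument. -/
noncomputable abbrev core : InnerProductSpace.Core ℂ (WeightedSeries w E) where
  inner f g := ∑' n, ((w n : ℝ) : ℂ) * inner ℂ (f n) (g n)
  conj_inner_symm f g := by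
    rw [Complex.conj_tsum]
    refine tsum_congr (fun n => ?_)
    rw [map_mul, Complex.conj_ofReal, inner_conj_symm]
  re_inner_nonneg f := by
    simp only [inner_self_term]
    rw [← Complex.ofReal_tsum]
    exact tsum_nonneg (fun n => mul_nonneg (sq_nonneg _) (w n).2.le)
  add_left f g h := by
    rw [← (summable_inner f h).tsum_add (summable_inner g h)]
    refine tsum_congr (fun n => ?_)
    rw [← mul_add, ← inner_add_left]
    rfl
  smul_left f g c := by
    rw [← tsum_mul_left]
    refine tsum_congr (fun n => ?_)
    rw [mul_left_comm, ← inner_smul_left]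
    rfl
  definite f hf := by
    simp only [inner_self_term] at hf
    rw [← Complex.ofReal_tsum, Complex.ofReal_eq_zero] at hf
    have h1 := (hasSum_zero_iff_of_nonneg
      (fun n => mul_nonneg (sq_nonneg ‖f n‖) (w n).2.le)).1 (hf ▸ f.summable.hasSum)
    refine ext (fun n => ?_)
    have h2 : f n = 0 := by simpa [(w n).2.ne'] using congrFun h1 n
    exact h2

noncomputable instance instNormedAddCommGroup : NormedAddCommGroup (WeightedSeries w E) :=
  core.toNormedAddCommGroup

noncomputable instance instInnerProductSpace : InnerProductSpace ℂ (WeightedSeries w E) :=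
  InnerProductSpace.ofCore core.toCore

theorem norm_sq_eq (f : WeightedSeries w E) : ‖f‖ ^ 2 = ∑' n, ‖f n‖ ^ 2 * (w n : ℝ) := by
  have h : inner ℂ f f = ∑' n, ((w n : ℝ) : ℂ) * inner ℂ (f n) (f n) := rfl
  simp only [inner_self_term] at h
  rw [inner_self_eq_norm_sq_to_K, ← Complex.ofReal_tsum] at h
  exact Complex.ofReal_injective (by simpa using h)

end WeightedSeries

/-- The backward shift `f(t) ↦ (f(t) - f(0)) / t` on the space of `E`-valued power series with
weights `w`, that is, the operator `B_w ⊗ I_E`. It is a bounded operator as soon as the quotients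
`wₙ / wₙ₊₁` are bounded. -/
noncomputable def backwardShift (w : PosWeight) (E : Type*) [NormedAddCommGroup E]
    [InnerProductSpace ℂ E] (hw : ∃ C : ℝ, ∀ n, (w n : ℝ) ≤ C * (w (n + 1) : ℝ)) :
    WeightedSeries w E →L[ℂ] WeightedSeries w E :=
  have hsum : ∀ f : WeightedSeries w E,
      Summable fun n => ‖f (n + 1)‖ ^ 2 * (w n : ℝ) := fun f => by
    obtain ⟨C, hC⟩ := hw
    refine Summable.of_nonneg_of_le (fun n => mul_nonneg (sq_nonneg _) (w n).2.le) (fun n => ?_)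
      (((summable_nat_add_iff 1).2 f.summable).mul_left C)
    have := mul_le_mul_of_nonneg_left (hC n) (sq_nonneg ‖f (n + 1)‖)
    linarith
  LinearMap.mkContinuousOfExistsBound
    { toFun := fun f => WeightedSeries.mk (fun n => f (n + 1)) (hsum f)
      map_add' := fun _ _ => rfl
      map_smul' := fun _ _ => rfl }
    (by
      obtain ⟨C, hC⟩ := hw
      have hC0 : 0 ≤ C := by
        by_contra h
        have h1 := hC 0
        have h2 := (w 0).2
        have h3 := (w (0 + 1)).2
        nlinarith
      refine ⟨√C, fun f => ?_⟩
      refine le_of_sq_le_sq ?_ (by positivity)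
      rw [mul_pow, Real.sq_sqrt hC0, WeightedSeries.norm_sq_eq, WeightedSeries.norm_sq_eq,
        f.summable.tsum_eq_zero_add, mul_add, ← tsum_mul_left]
      have h1 : ∑' n, ‖f (n + 1)‖ ^ 2 * (w n : ℝ)
          ≤ ∑' n, C * (‖f (n + 1)‖ ^ 2 * (w (n + 1) : ℝ)) := by
        refine Summable.tsum_le_tsum (fun n => ?_) (hsum f)
          (((summable_nat_add_iff 1).2 f.summable).mul_left C)
        have := mul_le_mul_of_nonneg_left (hC n) (sq_nonneg ‖f (n + 1)‖)
        linarith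
      have h2 : 0 ≤ C * (‖f 0‖ ^ 2 * (w 0 : ℝ)) :=
        mul_nonneg hC0 (mul_nonneg (sq_nonneg _) (w 0).2.le)
      exact h1.trans (by linarith))

theorem backwardShift_apply (w : PosWeight) (E : Type*) [NormedAddCommGroup E]
    [InnerProductSpace ℂ E] (hw : ∃ C : ℝ, ∀ n, (w n : ℝ) ≤ C * (w (n + 1) : ℝ))
    (f : WeightedSeries w E) (n : ℕ) : backwardShift w E hw f n = f (n + 1) := rfl

/-- The space `ℛ_k`: the scalar power series with weights `1 / kₙ`. -/
abbrev RSpace (k : PosWeight) : Type := WeightedSeries (fun n => (k n)⁻¹) ℂ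

/-- `ℛ_k` is a Banach algebra for the multiplication of power series: the (Cauchy) product of two
elements is again an element, and the product is bounded. -/
def RSpace.IsBanachAlgebra (k : PosWeight) : Prop :=
  ∃ C : ℝ, ∀ f g : RSpace k, ∃ h : RSpace k,
    (∀ n, h n = ∑ p ∈ Finset.HasAntidiagonal.antidiagonal n, f p.1 * g p.2) ∧ ‖h‖ ≤ C * ‖f‖ * ‖g‖

/-- The zero set, in the open unit disc, of the function `z ↦ ∑ fₙ zⁿ`. -/
def RSpace.zeroSet {k : PosWeight} (f : RSpace k) : Set ℂ :=
  {z | ‖z‖ < 1 ∧ HasSum (fun n => f n * z ^ n) 0}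

theorem RSpace.norm_sq_single {k : PosWeight} (f : RSpace k) (m : ℕ) (hm : f m = 1)
    (h : ∀ n, n ≠ m → f n = 0) : ‖f‖ ^ 2 = (k m : ℝ)⁻¹ := by
  rw [WeightedSeries.norm_sq_eq, tsum_eq_single m]
  · simp [hm]
  · intro n hn
    simp [h n hn]

/-- If `ℛ_k` is a Banach algebra, then multiplication by `z` is bounded on it, which means that the
quotients `kₙ / kₙ₊₁` are bounded. -/
theorem RSpace.IsBanachAlgebra.exists_bound {k : PosWeight} (hk : RSpace.IsBanachAlgebra k) :
    ∃ C : ℝ, ∀ n, (k n : ℝ) ≤ C * (k (n + 1) : ℝ) := by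
  obtain ⟨C, hC⟩ := hk
  have hs : ∀ m : ℕ, Summable fun n =>
      ‖(Pi.single m (1 : ℂ) : ℕ → ℂ) n‖ ^ 2 * (((k n)⁻¹ : {x : ℝ // 0 < x}) : ℝ) := fun m =>
    summable_of_ne_finset_zero (s := {m}) (fun n hn => by
      have : n ≠ m := by simpa using hn
      simp [this])
  let e : ℕ → RSpace k := fun m => WeightedSeries.mk (Pi.single m (1 : ℂ)) (hs m)
  have he : ∀ m n, e m n = (Pi.single m (1 : ℂ) : ℕ → ℂ) n := fun _ _ => rfl
  have hn : ∀ m, ‖e m‖ ^ 2 = (k m : ℝ)⁻¹ := fun m =>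
    RSpace.norm_sq_single (e m) m (by simp [he]) (fun n h => by simp [he, h])
  refine ⟨C ^ 2 * (k 1 : ℝ)⁻¹, fun m => ?_⟩
  obtain ⟨h, hh, hle⟩ := hC (e 1) (e m)
  have hcoef : ∀ n, h n = if n = m + 1 then 1 else 0 := by
    intro n
    rw [hh]
    by_cases hnm : n = m + 1
    · rw [if_pos hnm, Finset.sum_eq_single (1, m)]
      · simp [he]
      · rintro ⟨a, b⟩ _ hab
        by_cases ha : a = 1
        · have hb : b ≠ m := fun hb => hab (by rw [ha, hb])
          simp [he, hb]
        · simp [he, ha]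
      · intro hmem
        exact absurd (Finset.HasAntidiagonal.mem_antidiagonal.2 (by omega)) hmem
    · rw [if_neg hnm]
      refine Finset.sum_eq_zero ?_
      rintro ⟨a, b⟩ hab
      have hab' := Finset.HasAntidiagonal.mem_antidiagonal.1 hab
      by_cases ha : a = 1
      · have hb : b ≠ m := fun hb => hnm (by simp only at hab'; omega)
        simp [he, hb]
      · simp [he, ha]
  have h1 : ‖h‖ ^ 2 = (k (m + 1) : ℝ)⁻¹ :=
    RSpace.norm_sq_single h (m + 1) (by simp [hcoef]) (fun n hne => by simp [hcoef, hne])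
  have h2 : ‖h‖ ^ 2 ≤ (C * ‖e 1‖ * ‖e m‖) ^ 2 := pow_le_pow_left₀ (norm_nonneg _) hle 2
  rw [mul_pow, mul_pow, hn, hn, h1] at h2
  have p1 := (k m).2
  have p2 := (k (m + 1)).2
  have h3 := mul_le_mul_of_nonneg_right h2 (mul_pos p1 p2).le
  have e1 : (k (m + 1) : ℝ)⁻¹ * ((k m : ℝ) * (k (m + 1) : ℝ)) = (k m : ℝ) := by
    field_simp
  have e2 : C ^ 2 * (k 1 : ℝ)⁻¹ * (k m : ℝ)⁻¹ * ((k m : ℝ) * (k (m + 1) : ℝ))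
      = C ^ 2 * (k 1 : ℝ)⁻¹ * (k (m + 1) : ℝ) := by
    rw [mul_assoc (C ^ 2 * (k 1 : ℝ)⁻¹), inv_mul_cancel_left₀ p1.ne']
  rwa [e1, e2] at h3

/-- The standing assumptions on `α(t) = ∑ αₙ tⁿ` and `k(t) = ∑ kₙ tⁿ` (where `kₙ > 0`): the real
sequence `αₙ` is summable, `α` has no zeros in the open unit disc, `α₀ = k₀ = 1` and
`k(t) = 1 / α(t)` in the open unit disc. -/
structure IsReciprocalPair (α : ℕ → ℝ) (k : PosWeight) : Prop where
  summable_abs : Summable fun n => |α n|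
  ne_zero : ∀ t : ℂ, ‖t‖ < 1 → ∑' n, (α n : ℂ) * t ^ n ≠ 0
  alpha_zero : α 0 = 1
  k_zero : (k 0 : ℝ) = 1
  hasSum_k : ∀ t : ℂ, ‖t‖ < 1 →
    HasSum (fun n => ((k n : ℝ) : ℂ) * t ^ n) (1 / ∑' n, (α n : ℂ) * t ^ n)

/-- `T` is similar to a part of `A`, that is, to the restriction of `A` to a closed invariant
subspace `L`; the similarity is a bounded invertible operator from `H` onto `L`. -/
def IsSimilarToPart {H K : Type*} [NormedAddCommGroup H] [InnerProductSpace ℂ H]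
    [NormedAddCommGroup K] [InnerProductSpace ℂ K] (T : H →L[ℂ] H) (A : K →L[ℂ] K) : Prop :=
  ∃ L : Submodule ℂ K, IsClosed (L : Set K) ∧ (∀ x ∈ L, A x ∈ L) ∧
    ∃ S : H ≃L[ℂ] L, ∀ x : H, (S (T x) : K) = A (S x)

/-! Write `B` for the backward shift. The algebra `ℛ_k` acts on `ℋ_k ⊗ D` by `f(B) = ∑ fₙ Bⁿ`, a
consequence of the duality of `ℛ_k` and `ℋ_k` (`summable_sq_tsum_smul_shift`, `act`), and the action
preserves the invariant subspace `L` (`act_mem`). The limit of the infima gives `k (n + m) ≤ K rⁿ k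
m` for each `r > 1`. Hence for `|z| < 1` the eigenvectors `ε_z(e) = ∑ zⁿ e tⁿ` lie in `ℋ_k ⊗ D`, and
`ℛ_k` is closed under difference quotients.

Let `z` in the disc be outside `σ(T)`, so that `L` contains no nonzero `ε_z(e)`. Let `y i` be the
projections to `Lᗮ` of the vectors `ε_z(b i)`, with `b` an orthonormal basis of `D`. The functions
`g i j : w ↦ ⟨y i, ε_w(b j)⟩` belong to `ℛ_k`, and `∑ⱼ (g i j)(B) xⱼ = 0` for the coordinates `xⱼ`
of any `x ∈ L`. By Cramer's rule `f = det (g i j)` satisfies `f(B) = 0` on `L`. At `z` the matrix is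
the Gram matrix of the `y i`, which are independent, so `f ≠ 0` (`exists_annihilator`).

If `|w| < 1` and `f(w) ≠ 0`, write `f = f(w) + (X - w) h` with `h ∈ ℛ_k`. Then `-f(w)⁻¹ h(B)`
inverts `B - w` on `L`, so `w ∉ σ(T)` (`bijOn_backwardShift_sub`). -/

namespace WeightedSeries

variable {k : PosWeight} {E : Type*} [NormedAddCommGroup E] [InnerProductSpace ℂ E]

/-! ### Coefficients, and the duality between `ℛ_k` and `ℋ_k` -/

theorem coeff_mk {w : PosWeight} (f : ℕ → E) (hf : Summable fun n => ‖f n‖ ^ 2 * (w n : ℝ))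
    (n : ℕ) : mk (w := w) f hf n = f n := rfl

theorem coeff_add {w : PosWeight} (f g : WeightedSeries w E) (n : ℕ) : (f + g) n = f n + g n := rfl

theorem coeff_smul {w : PosWeight} (c : ℂ) (f : WeightedSeries w E) (n : ℕ) :
    (c • f) n = c • f n := rfl

theorem inner_eq {w : PosWeight} (f g : WeightedSeries w E) :
    inner ℂ f g = ∑' n, ((w n : ℝ) : ℂ) * inner ℂ (f n) (g n) := rfl

/-- The evaluation of the `n`-th coefficient. -/
def coeffHom (w : PosWeight) (E : Type*) [NormedAddCommGroup E] [InnerProductSpace ℂ E] (n : ℕ) :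
    WeightedSeries w E →ₗ[ℂ] E where
  toFun f := f n
  map_add' _ _ := rfl
  map_smul' _ _ := rfl

theorem coeff_sum {w : PosWeight} {ι : Type*} (s : Finset ι) (f : ι → WeightedSeries w E) (n : ℕ) :
    (∑ i ∈ s, f i) n = ∑ i ∈ s, f i n :=
  map_sum (coeffHom w E n) f s

/-- The series of the norms of the coefficients. -/
noncomputable def abs {w : PosWeight} (f : WeightedSeries w E) : WeightedSeries w ℂ :=
  mk (fun n => (‖f n‖ : ℂ)) (by simpa using f.summable)

theorem abs_apply {w : PosWeight} (f : WeightedSeries w E) (n : ℕ) : f.abs n = (‖f n‖ : ℂ) := rfl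

theorem norm_abs {w : PosWeight} (f : WeightedSeries w E) : ‖f.abs‖ = ‖f‖ := by
  rw [← sq_eq_sq₀ (norm_nonneg _) (norm_nonneg _), norm_sq_eq, norm_sq_eq]
  simp [abs_apply]

/-- The norms of the coefficients of an element of `ℋ_k ⊗ E`, weighted so as to lie in the dual
space `ℛ_k`. -/
noncomputable def dual (y : WeightedSeries k E) : RSpace k :=
  mk (fun n => ((k n * ‖y n‖ : ℝ) : ℂ)) (by
    refine y.summable.congr fun n => ?_
    have h := (k n).2.ne'
    have h0 := (k n).2.le
    simp only [Complex.norm_real, norm_mul, norm_norm, Real.norm_of_nonneg h0, Positive.coe_inv]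
    field_simp)

theorem norm_dual_apply (y : WeightedSeries k E) (n : ℕ) : ‖y.dual n‖ = k n * ‖y n‖ := by
  have h0 := (k n).2.le
  simp [dual, coeff_mk, abs_of_nonneg h0]

/-- Cauchy–Schwarz: the weights `1 / kₙ` and `kₙ` cancel, which makes `ℛ_k` dual to `ℋ_k` under the
unweighted pairing. -/
theorem sum_mul_le_norm_mul_norm (g : RSpace k) (x : WeightedSeries k E) (s : Finset ℕ) :
    ∑ n ∈ s, ‖g n‖ * ‖x n‖ ≤ ‖g‖ * ‖x‖ := by
  refine le_of_sq_le_sq ?_ (by positivity)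
  rw [mul_pow, norm_sq_eq, norm_sq_eq]
  have hg := g.summable.sum_le_tsum s fun n _ =>
    mul_nonneg (sq_nonneg ‖g n‖) ((k n)⁻¹).2.le
  have hx := x.summable.sum_le_tsum s fun n _ => mul_nonneg (sq_nonneg ‖x n‖) (k n).2.le
  refine le_trans ?_ (mul_le_mul hg hx
    (Finset.sum_nonneg fun n _ => mul_nonneg (sq_nonneg ‖x n‖) (k n).2.le)
    (tsum_nonneg fun n => mul_nonneg (sq_nonneg ‖g n‖) ((k n)⁻¹).2.le))
  refine Finset.sum_sq_le_sum_mul_sum_of_sq_le_mul s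
    (fun n _ => mul_nonneg (sq_nonneg ‖g n‖) ((k n)⁻¹).2.le)
    (fun n _ => mul_nonneg (sq_nonneg ‖x n‖) (k n).2.le) fun n _ => le_of_eq ?_
  have h := (k n).2.ne'
  simp only [Positive.coe_inv]
  field_simp

theorem summable_norm_mul_norm (g : RSpace k) (x : WeightedSeries k E) :
    Summable fun n => ‖g n‖ * ‖x n‖ :=
  summable_of_sum_le (fun _ => by positivity) (sum_mul_le_norm_mul_norm g x)

theorem tsum_norm_mul_norm_le (g : RSpace k) (x : WeightedSeries k E) :
    ∑' n, ‖g n‖ * ‖x n‖ ≤ ‖g‖ * ‖x‖ :=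
  (summable_norm_mul_norm g x).tsum_le_of_sum_le (sum_mul_le_norm_mul_norm g x)

end WeightedSeries

open WeightedSeries

theorem backwardShift_pow_apply {k : PosWeight} {E : Type*} [NormedAddCommGroup E]
    [InnerProductSpace ℂ E] (hw : ∃ C : ℝ, ∀ n, (k n : ℝ) ≤ C * (k (n + 1) : ℝ))
    (m : ℕ) (x : WeightedSeries k E) (n : ℕ) :
    (backwardShift k E hw ^ m) x n = x (n + m) := by
  induction m generalizing x n with
  | zero => rfl
  | succ m ih =>
    rw [pow_succ, mul_apply_eq_comp, ih, backwardShift_apply, add_assoc]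

theorem backwardShift_pow_mem {k : PosWeight} {E : Type*} [NormedAddCommGroup E]
    [InnerProductSpace ℂ E] (hw : ∃ C : ℝ, ∀ n, (k n : ℝ) ≤ C * (k (n + 1) : ℝ))
    (L : Submodule ℂ (WeightedSeries k E)) (hL : ∀ x ∈ L, backwardShift k E hw x ∈ L)
    {x : WeightedSeries k E} (hx : x ∈ L) (n : ℕ) : (backwardShift k E hw ^ n) x ∈ L := by
  induction n with
  | zero => exact hx
  | succ n ih =>
    rw [pow_succ', mul_apply_eq_comp]
    exact hL _ ih

/-! ### The functional calculus of `ℛ_k` -/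

namespace RSpace

variable {k : PosWeight} {E : Type*} [NormedAddCommGroup E] [InnerProductSpace ℂ E]

/-- If `ℛ_k` is a Banach algebra, the double sums `∑ gₘ hₙ xₘ₊ₙ` converge absolutely. -/
theorem IsBanachAlgebra.exists_tsum_triple_le (hk : IsBanachAlgebra k) : ∃ C : ℝ, 0 ≤ C ∧
    ∀ (g h : RSpace k) (x : WeightedSeries k E),
      (Summable fun p : ℕ × ℕ => ‖g p.1‖ * ‖h p.2‖ * ‖x (p.1 + p.2)‖) ∧
      ∑' p : ℕ × ℕ, ‖g p.1‖ * ‖h p.2‖ * ‖x (p.1 + p.2)‖ ≤ C * ‖g‖ * ‖h‖ * ‖x‖ := by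
  obtain ⟨C, hC⟩ := hk
  refine ⟨max C 0, le_max_right _ _, fun g h x => ?_⟩
  -- Summing along the antidiagonals turns the double sum into the pairing of `x` with `q`, the
  -- product of the series of absolute values.
  obtain ⟨q, hq, hle⟩ := hC (WeightedSeries.abs g) (WeightedSeries.abs h)
  simp only [norm_abs] at hle
  have hqn : ∀ n, ‖q n‖ = ∑ p ∈ Finset.HasAntidiagonal.antidiagonal n, ‖g p.1‖ * ‖h p.2‖ := by
    intro n
    have : q n = ((∑ p ∈ Finset.HasAntidiagonal.antidiagonal n, ‖g p.1‖ * ‖h p.2‖ : ℝ) : ℂ) := by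
      rw [hq]
      push_cast
      rfl
    rw [this, Complex.norm_real, Real.norm_of_nonneg]
    exact Finset.sum_nonneg fun p _ => by positivity
  have hfib : ∀ n, ∑' p : Finset.HasAntidiagonal.antidiagonal n,
      ‖g p.1.1‖ * ‖h p.1.2‖ * ‖x (p.1.1 + p.1.2)‖ = ‖q n‖ * ‖x n‖ := by
    intro n
    rw [hqn, Finset.sum_mul,
      Finset.tsum_subtype (Finset.HasAntidiagonal.antidiagonal n)
        (fun p : ℕ × ℕ => ‖g p.1‖ * ‖h p.2‖ * ‖x (p.1 + p.2)‖)]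
    refine Finset.sum_congr rfl fun p hp => ?_
    rw [Finset.HasAntidiagonal.mem_antidiagonal.1 hp]
  have hsig : Summable fun c : Σ n : ℕ, Finset.HasAntidiagonal.antidiagonal n =>
      ‖g c.2.1.1‖ * ‖h c.2.1.2‖ * ‖x (c.2.1.1 + c.2.1.2)‖ := by
    refine (summable_sigma_of_nonneg fun _ => by positivity).2
      ⟨fun n => (hasSum_fintype _).summable, ?_⟩
    exact (summable_norm_mul_norm q x).congr fun n => (hfib n).symm
  have hprod := (Finset.HasAntidiagonal.sigmaAntidiagonalEquivProd (A := ℕ)).summable_iff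
    (f := fun p : ℕ × ℕ => ‖g p.1‖ * ‖h p.2‖ * ‖x (p.1 + p.2)‖)
  refine ⟨hprod.1 hsig, ?_⟩
  rw [← (Finset.HasAntidiagonal.sigmaAntidiagonalEquivProd (A := ℕ)).tsum_eq]
  refine (hsig.tsum_sigma' fun n => (hasSum_fintype _).summable).trans_le ?_
  rw [tsum_congr hfib]
  refine (tsum_norm_mul_norm_le q x).trans ?_
  have h1 : ‖q‖ ≤ max C 0 * ‖g‖ * ‖h‖ := hle.trans (by gcongr; exact le_max_left _ _)
  gcongr

theorem IsBanachAlgebra.summable_triple (hk : IsBanachAlgebra k) (g h : RSpace k)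
    (x : WeightedSeries k E) :
    Summable fun p : ℕ × ℕ => ‖g p.1‖ * ‖h p.2‖ * ‖x (p.1 + p.2)‖ :=
  (hk.exists_tsum_triple_le.choose_spec.2 g h x).1

theorem IsBanachAlgebra.summable_mul_shift (hk : IsBanachAlgebra k) (g : RSpace k)
    (x : WeightedSeries k E) (m : ℕ) : Summable fun n => ‖g n‖ * ‖x (n + m)‖ := by
  simpa only [backwardShift_pow_apply] using
    summable_norm_mul_norm g ((backwardShift k E hk.exists_bound ^ m) x)

theorem IsBanachAlgebra.summable_smul_shift [CompleteSpace E] (hk : IsBanachAlgebra k)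
    (g : RSpace k) (x : WeightedSeries k E) (m : ℕ) : Summable fun n => g n • x (n + m) :=
  Summable.of_norm (by simpa only [norm_smul] using hk.summable_mul_shift g x m)

/-- Well-definedness of `g(B) x`, by duality: pairing it with `u` amounts to pairing `x` with the
product of `g` and the dual series of `u`, which the algebra norm controls. -/
theorem IsBanachAlgebra.summable_sq_tsum_smul_shift (hk : IsBanachAlgebra k)
    (g : RSpace k) (x : WeightedSeries k E) :
    Summable fun m => ‖∑' n, g n • x (n + m)‖ ^ 2 * (k m : ℝ) := by
  obtain ⟨C, hC0, hC⟩ := hk.exists_tsum_triple_le (E := E)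
  set v : ℕ → ℝ := fun m => ‖∑' n, g n • x (n + m)‖ with hv
  have hv0 : ∀ m, 0 ≤ v m := fun m => norm_nonneg _
  have hvle : ∀ m, v m ≤ ∑' n, ‖g n‖ * ‖x (n + m)‖ := fun m => by
    have hs := hk.summable_mul_shift g x m
    simp only [← norm_smul] at hs ⊢
    exact norm_tsum_le_tsum_norm hs
  refine summable_of_sum_range_le (c := (C * ‖g‖ * ‖x‖) ^ 2)
    (fun m => mul_nonneg (sq_nonneg _) (k m).2.le) fun M => ?_
  set Q := ∑ m ∈ Finset.range M, v m ^ 2 * (k m : ℝ)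
  have hQ0 : 0 ≤ Q := Finset.sum_nonneg fun m _ => mul_nonneg (sq_nonneg _) (k m).2.le
  -- The test series is a truncation of `v` itself, so that `Q = ‖u.dual‖²` is finite and `Q ≤ c
  -- ‖u.dual‖` yields `Q ≤ c²`.
  let u : WeightedSeries k ℂ := WeightedSeries.mk
    (fun m => if m ∈ Finset.range M then (v m : ℂ) else 0)
    (summable_of_ne_finset_zero (s := Finset.range M) fun m hm => by simp only [if_neg hm]; simp)
  have hu : ∀ m, ‖u.dual m‖ = if m ∈ Finset.range M then k m * v m else 0 := fun m => by
    rw [norm_dual_apply, coeff_mk]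
    split_ifs <;> simp [abs_of_nonneg (hv0 m)]
  have hun : ‖u.dual‖ ^ 2 = Q := by
    rw [norm_sq_eq, tsum_eq_sum (s := Finset.range M) fun m hm => by rw [hu, if_neg hm]; simp]
    refine Finset.sum_congr rfl fun m hm => ?_
    have h := (k m).2.ne'
    rw [hu, if_pos hm, Positive.coe_inv]
    field_simp
  obtain ⟨hs, hle⟩ := hC u.dual g x
  have h1 : Q ≤ ∑' m, ‖u.dual m‖ * ∑' n, ‖g n‖ * ‖x (n + m)‖ := by
    rw [tsum_eq_sum (s := Finset.range M) fun m hm => by rw [hu, if_neg hm]; simp]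
    refine Finset.sum_le_sum fun m hm => ?_
    rw [hu, if_pos hm]
    have := mul_le_mul_of_nonneg_left (hvle m) (mul_nonneg (k m).2.le (hv0 m))
    nlinarith
  have h2 : ∑' m, ‖u.dual m‖ * ∑' n, ‖g n‖ * ‖x (n + m)‖
      = ∑' p : ℕ × ℕ, ‖u.dual p.1‖ * ‖g p.2‖ * ‖x (p.1 + p.2)‖ := by
    rw [hs.tsum_prod]
    refine tsum_congr fun m => ?_
    rw [← tsum_mul_left]
    exact tsum_congr fun n => by rw [add_comm n m]; ring
  rw [h2] at h1
  have h3 : Q ≤ C * ‖g‖ * ‖x‖ * ‖u.dual‖ := (h1.trans hle).trans_eq (by ring)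
  have h4 : 0 ≤ C * ‖g‖ * ‖x‖ := by positivity
  nlinarith [norm_nonneg u.dual, sq_nonneg (‖u.dual‖ - C * ‖g‖ * ‖x‖)]

/-- `ℛ_k` as an algebra of formal power series. -/
def algebra (hk : IsBanachAlgebra k) : Subalgebra ℂ (PowerSeries ℂ) where
  carrier := {φ | Summable fun n => ‖φ.coeff n‖ ^ 2 * (((k n)⁻¹ : {x : ℝ // 0 < x}) : ℝ)}
  mul_mem' := by
    intro φ ψ hφ hψ
    obtain ⟨_, hC⟩ := hk
    obtain ⟨q, hq, -⟩ := hC (WeightedSeries.mk _ hφ) (WeightedSeries.mk _ hψ)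
    refine q.summable.congr fun n => ?_
    rw [hq, PowerSeries.coeff_mul]
    rfl
  add_mem' := by
    intro φ ψ hφ hψ
    exact (WeightedSeries.mk (w := fun n => (k n)⁻¹) _ hφ + WeightedSeries.mk _ hψ).summable
  algebraMap_mem' c := by
    refine summable_of_ne_finset_zero (s := {0}) fun n hn => ?_
    have : n ≠ 0 := by simpa using hn
    simp [PowerSeries.coeff_C, this]

/-- An element of the algebra `ℛ_k`, as an element of the Hilbert space `ℛ_k`. -/
noncomputable def toSeries {hk : IsBanachAlgebra k} (φ : algebra hk) : RSpace k :=
  WeightedSeries.mk (fun n => φ.1.coeff n) φ.2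

theorem toSeries_apply {hk : IsBanachAlgebra k} (φ : algebra hk) (n : ℕ) :
    toSeries φ n = φ.1.coeff n := rfl

theorem X_mem_algebra (hk : IsBanachAlgebra k) : (PowerSeries.X : PowerSeries ℂ) ∈ algebra hk := by
  refine summable_of_ne_finset_zero (s := {1}) fun n hn => ?_
  have : n ≠ 1 := by simpa using hn
  simp [PowerSeries.coeff_X, this]

/-- The operator `φ(B_k ⊗ I_E)` on `ℋ_k ⊗ E`. -/
noncomputable def actLinear [CompleteSpace E] {hk : IsBanachAlgebra k} (φ : algebra hk) :
    WeightedSeries k E →ₗ[ℂ] WeightedSeries k E where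
  toFun x := WeightedSeries.mk (fun m => ∑' n, φ.1.coeff n • x (n + m))
    (hk.summable_sq_tsum_smul_shift (toSeries φ) x)
  map_add' x y := by
    refine WeightedSeries.ext fun m => ?_
    refine (tsum_congr fun n => smul_add _ _ _).trans ?_
    exact (hk.summable_smul_shift (toSeries φ) x m).tsum_add
      (hk.summable_smul_shift (toSeries φ) y m)
  map_smul' c x := by
    refine WeightedSeries.ext fun m => ?_
    refine (tsum_congr fun n => smul_comm _ c _).trans ?_
    exact (hk.summable_smul_shift (toSeries φ) x m).tsum_const_smul c

theorem actLinear_apply [CompleteSpace E] {hk : IsBanachAlgebra k} (φ : algebra hk) (x : WeightedSeries k E) (m : ℕ) :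
    actLinear φ x m = ∑' n, φ.1.coeff n • x (n + m) := rfl

theorem actLinear_mul [CompleteSpace E] {hk : IsBanachAlgebra k} (φ ψ : algebra hk) (x : WeightedSeries k E) :
    actLinear (φ * ψ) x = actLinear φ (actLinear ψ x) := by
  refine WeightedSeries.ext fun m => ?_
  simp only [actLinear_apply]
  have hs : Summable fun p : ℕ × ℕ =>
      (φ.1.coeff p.1 * ψ.1.coeff p.2) • x (p.1 + p.2 + m) := by
    refine Summable.of_norm ?_
    simpa only [backwardShift_pow_apply, norm_smul, norm_mul, toSeries_apply] using
      hk.summable_triple (toSeries φ) (toSeries ψ) ((backwardShift k E hk.exists_bound ^ m) x)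
  have hsig := (Finset.HasAntidiagonal.sigmaAntidiagonalEquivProd (A := ℕ)).summable_iff.2 hs
  have h1 : ∑' p : ℕ × ℕ, (φ.1.coeff p.1 * ψ.1.coeff p.2) • x (p.1 + p.2 + m)
      = ∑' n, (φ * ψ).1.coeff n • x (n + m) := by
    rw [← (Finset.HasAntidiagonal.sigmaAntidiagonalEquivProd (A := ℕ)).tsum_eq]
    refine (hsig.tsum_sigma' fun n => (hasSum_fintype _).summable).trans (tsum_congr fun n => ?_)
    refine (Finset.tsum_subtype (Finset.HasAntidiagonal.antidiagonal n)
      (fun p : ℕ × ℕ => (φ.1.coeff p.1 * ψ.1.coeff p.2) • x (p.1 + p.2 + m))).trans ?_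
    rw [MulMemClass.coe_mul, PowerSeries.coeff_mul, Finset.sum_smul]
    refine Finset.sum_congr rfl fun p hp => ?_
    rw [Finset.HasAntidiagonal.mem_antidiagonal.1 hp]
  rw [← h1, hs.tsum_prod]
  refine tsum_congr fun n => ?_
  refine Eq.trans (tsum_congr fun l => ?_)
    ((hk.summable_smul_shift (toSeries ψ) x (n + m)).tsum_const_smul (φ.1.coeff n))
  rw [mul_smul, toSeries_apply, add_right_comm, add_comm (n + m) l]

theorem actLinear_algebraMap [CompleteSpace E] {hk : IsBanachAlgebra k} (c : ℂ) (x : WeightedSeries k E) :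
    actLinear (algebraMap ℂ (algebra hk) c) x = c • x := by
  refine WeightedSeries.ext fun m => ?_
  rw [actLinear_apply, tsum_eq_single 0, coeff_smul]
  · simp
  · intro n hn
    simp [PowerSeries.coeff_C, hn]

/-- The functional calculus `φ ↦ φ(B_k ⊗ I_E)` of `ℛ_k`. -/
noncomputable def act (hk : IsBanachAlgebra k) (E : Type*) [NormedAddCommGroup E]
    [InnerProductSpace ℂ E] [CompleteSpace E] :
    algebra hk →ₐ[ℂ] Module.End ℂ (WeightedSeries k E) where
  toFun := actLinear
  map_one' := LinearMap.ext fun x => by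
    rw [← map_one (algebraMap ℂ (algebra hk)), actLinear_algebraMap, one_smul]
    rfl
  map_mul' φ ψ := LinearMap.ext (actLinear_mul φ ψ)
  map_zero' := LinearMap.ext fun x => by
    rw [← map_zero (algebraMap ℂ (algebra hk)), actLinear_algebraMap, zero_smul]
    rfl
  map_add' φ ψ := LinearMap.ext fun x => WeightedSeries.ext fun m => by
    simp only [LinearMap.add_apply, coeff_add, actLinear_apply]
    simp only [AddMemClass.coe_add, map_add, add_smul]
    exact (hk.summable_smul_shift (toSeries φ) x m).tsum_add
      (hk.summable_smul_shift (toSeries ψ) x m)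
  commutes' c := LinearMap.ext fun x => actLinear_algebraMap c x

theorem act_apply [CompleteSpace E] {hk : IsBanachAlgebra k} (φ : algebra hk) (x : WeightedSeries k E) (m : ℕ) :
    act hk E φ x m = ∑' n, φ.1.coeff n • x (n + m) := rfl

theorem act_X [CompleteSpace E] (hk : IsBanachAlgebra k) (x : WeightedSeries k E) :
    act hk E ⟨PowerSeries.X, X_mem_algebra hk⟩ x = backwardShift k E hk.exists_bound x := by
  refine WeightedSeries.ext fun m => ?_
  rw [act_apply, tsum_eq_single 1, backwardShift_apply]
  · simp [add_comm]
  · intro n hn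
    simp [PowerSeries.coeff_X, hn]

theorem summable_inner_triple {hk : IsBanachAlgebra k} (φ : algebra hk)
    (y x : WeightedSeries k E) : Summable fun p : ℕ × ℕ =>
      ((k p.1 : ℝ) : ℂ) * (φ.1.coeff p.2 * inner ℂ (y p.1) (x (p.2 + p.1))) := by
  refine Summable.of_norm_bounded (hk.summable_triple y.dual (toSeries φ) x) fun p => ?_
  have h := norm_inner_le_norm (𝕜 := ℂ) (y p.1) (x (p.1 + p.2))
  have h0 := (k p.1).2.le
  rw [norm_mul, norm_mul, norm_dual_apply, Complex.norm_real, Real.norm_of_nonneg h0,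
    toSeries_apply, Nat.add_comm p.2]
  calc (k p.1 : ℝ) * (‖φ.1.coeff p.2‖ * ‖inner ℂ (y p.1) (x (p.1 + p.2))‖)
      ≤ (k p.1 : ℝ) * (‖φ.1.coeff p.2‖ * (‖y p.1‖ * ‖x (p.1 + p.2)‖)) := by gcongr
    _ = (k p.1 : ℝ) * ‖y p.1‖ * ‖φ.1.coeff p.2‖ * ‖x (p.1 + p.2)‖ := by ring

theorem inner_act_eq_tsum_tsum [CompleteSpace E] {hk : IsBanachAlgebra k} (φ : algebra hk)
    (y x : WeightedSeries k E) : inner ℂ y (act hk E φ x) = ∑' m, ∑' n,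
      ((k m : ℝ) : ℂ) * (φ.1.coeff n * inner ℂ (y m) (x (n + m))) := by
  refine tsum_congr fun m => ?_
  rw [tsum_mul_left, act_apply]
  congr 1
  refine ((innerSL ℂ (y m)).map_tsum (hk.summable_smul_shift (toSeries φ) x m)).trans ?_
  exact tsum_congr fun n => inner_smul_right _ _ _

/-- Weak form of `φ(B) = ∑ φₙ Bⁿ`, obtained by exchanging two absolutely convergent sums; norm
convergence of the operator series is not needed. -/
theorem inner_act [CompleteSpace E] {hk : IsBanachAlgebra k} (φ : algebra hk)
    (y x : WeightedSeries k E) : inner ℂ y (act hk E φ x) =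
      ∑' n, φ.1.coeff n * inner ℂ y ((backwardShift k E hk.exists_bound ^ n) x) := by
  rw [inner_act_eq_tsum_tsum, ← Summable.tsum_comm (f := fun m n =>
    ((k m : ℝ) : ℂ) * (φ.1.coeff n * inner ℂ (y m) (x (n + m)))) (summable_inner_triple φ y x)]
  refine tsum_congr fun n => ?_
  rw [inner_eq, ← tsum_mul_left]
  refine tsum_congr fun m => ?_
  rw [backwardShift_pow_apply, Nat.add_comm n m, mul_left_comm]

/-- `φ(B_k ⊗ I_E)` maps a closed invariant subspace of `B_k ⊗ I_E` to itself. -/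
theorem act_mem [CompleteSpace E] {hk : IsBanachAlgebra k} (φ : algebra hk)
    (L : Submodule ℂ (WeightedSeries k E)) [L.HasOrthogonalProjection]
    (hL : ∀ x ∈ L, backwardShift k E hk.exists_bound x ∈ L)
    {x : WeightedSeries k E} (hx : x ∈ L) : act hk E φ x ∈ L := by
  -- Since `L = Lᗮᗮ`, it is enough to test against `y ∈ Lᗮ`, where every term `⟨y, Bⁿ x⟩` vanishes.
  rw [← L.orthogonal_orthogonal, Submodule.mem_orthogonal]
  intro y hy
  rw [inner_act]
  refine (tsum_congr fun n => ?_).trans tsum_zero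
  rw [Submodule.inner_left_of_mem_orthogonal (backwardShift_pow_mem _ L hL hx n) hy, mul_zero]

end RSpace

/-! ### Growth of the weights and division by `X - z` -/

namespace RSpace

variable {k : PosWeight}

/-- For large `n` the infimum exceeds `r⁻ⁿ`, which is the bound with `K = 1`. The remaining `n` are
reached by going up a fixed number of indices, at the cost of a power of `C`. -/
theorem IsBanachAlgebra.exists_growth_bound (hk : IsBanachAlgebra k)
    (hr : Tendsto (fun n : ℕ => (⨅ j : ℕ, (k j : ℝ) / (k (n + j) : ℝ)) ^ (1 / (n : ℝ)))
      atTop (𝓝 1)) {r : ℝ} (hr1 : 1 < r) :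
    ∃ K : ℝ, 0 ≤ K ∧ ∀ n m, (k (n + m) : ℝ) ≤ K * r ^ n * k m := by
  obtain ⟨C, hC⟩ := hk.exists_bound
  have hr0 : 0 < r := by linarith
  have hC0 : 0 ≤ C := by
    have h1 := hC 0
    have h2 := (k 0).2
    have h3 := (k (0 + 1)).2
    by_contra h
    nlinarith
  have hpow : ∀ N n, (k n : ℝ) ≤ C ^ N * k (N + n) := by
    intro N n
    induction N with
    | zero => simp
    | succ N ih =>
      refine ih.trans ?_
      have := mul_le_mul_of_nonneg_left (hC (N + n)) (pow_nonneg hC0 N)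
      rw [pow_succ, add_right_comm, mul_assoc]
      exact this
  obtain ⟨N, hN⟩ := eventually_atTop.1 (hr.eventually (lt_mem_nhds (inv_lt_one_of_one_lt₀ hr1)))
  have hlarge : ∀ n, N + 1 ≤ n → ∀ m, (k (n + m) : ℝ) ≤ r ^ n * k m := by
    intro n hn m
    have hn0 : n ≠ 0 := by omega
    have h1 := hN n (by omega)
    set c := ⨅ j : ℕ, (k j : ℝ) / (k (n + j) : ℝ)
    have hq : ∀ j : ℕ, 0 ≤ (k j : ℝ) / (k (n + j) : ℝ) := fun j =>
      div_nonneg (k j).2.le (k (n + j)).2.le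
    have hc0 : 0 ≤ c := Real.iInf_nonneg hq
    have h2 : r⁻¹ ^ n < c := by
      calc r⁻¹ ^ n < (c ^ (1 / (n : ℝ))) ^ n := by gcongr
        _ = c := by rw [one_div, Real.rpow_inv_natCast_pow hc0 hn0]
    have h3 : c ≤ (k m : ℝ) / (k (n + m) : ℝ) := ciInf_le ⟨0, by rintro _ ⟨j, rfl⟩; exact hq j⟩ m
    have h4 := h2.le.trans h3
    rw [inv_pow, le_div_iff₀ (k (n + m)).2, inv_mul_le_iff₀ (by positivity)] at h4
    exact h4
  -- Compare `k (n + m)` with `k (N + 1 + n + m)`, to which the bound for large indices applies for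
  -- every `n`.
  refine ⟨C ^ (N + 1) * r ^ (N + 1), by positivity, fun n m => ?_⟩
  have h1 := hpow (N + 1) (n + m)
  have h2 := hlarge (N + 1 + n) (by omega) m
  rw [← add_assoc] at h1
  refine h1.trans ((mul_le_mul_of_nonneg_left h2 (by positivity)).trans_eq ?_)
  rw [pow_add r (N + 1) n]
  ring

/-- The eigenvectors `∑ zⁿ e tⁿ` of the backward shift belong to `ℋ_k ⊗ E`. -/
theorem summable_eigenvector
    (hgrowth : ∀ r : ℝ, 1 < r → ∃ K : ℝ, 0 ≤ K ∧ ∀ n m, (k (n + m) : ℝ) ≤ K * r ^ n * k m)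
    {E : Type*} [NormedAddCommGroup E] [InnerProductSpace ℂ E] {z : ℂ} (hz : ‖z‖ < 1) (e : E) :
    Summable fun n => ‖z ^ n • e‖ ^ 2 * (k n : ℝ) := by
  obtain ⟨r, hr1, hr2⟩ : ∃ r : ℝ, 1 < r ∧ r * ‖z‖ ^ 2 < 1 := by
    have : Tendsto (fun r : ℝ => r * ‖z‖ ^ 2) (𝓝[>] 1) (𝓝 (1 * ‖z‖ ^ 2)) :=
      ((continuous_id.mul continuous_const).tendsto 1).mono_left nhdsWithin_le_nhds
    have h1 : 1 * ‖z‖ ^ 2 < 1 := by nlinarith [norm_nonneg z]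
    obtain ⟨r, h, h'⟩ := ((this.eventually (gt_mem_nhds h1)).and self_mem_nhdsWithin).exists
    exact ⟨r, h', h⟩
  obtain ⟨K, hK, hKk⟩ := hgrowth r hr1
  refine Summable.of_nonneg_of_le (fun n => mul_nonneg (sq_nonneg _) (k n).2.le) (fun n => ?_)
    ((summable_geometric_of_lt_one (by positivity) hr2).mul_left (‖e‖ ^ 2 * K * k 0))
  have := mul_le_mul_of_nonneg_left (hKk n 0) (sq_nonneg ‖z ^ n • e‖)
  rw [add_zero] at this
  refine this.trans_eq ?_
  rw [norm_smul, norm_pow]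
  ring

theorem summable_mul_pow
    (hgrowth : ∀ r : ℝ, 1 < r → ∃ K : ℝ, 0 ≤ K ∧ ∀ n m, (k (n + m) : ℝ) ≤ K * r ^ n * k m)
    (f : RSpace k) {z : ℂ} (hz : ‖z‖ < 1) : Summable fun n => ‖f n‖ * ‖z‖ ^ n := by
  simpa [coeff_mk] using summable_norm_mul_norm f
    (WeightedSeries.mk _ (summable_eigenvector hgrowth hz (1 : ℂ)))

/-- Each shifted series is bounded by the sum of `u`, so Tonelli leaves a geometric series. -/
theorem summable_geometric_mul_shift {u : ℕ → ℝ} (hu0 : ∀ n, 0 ≤ u n) (hu : Summable u) {t : ℝ}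
    (ht0 : 0 ≤ t) (ht1 : t < 1) :
    Summable fun p : ℕ × ℕ => t ^ p.1 * u (p.2 + (1 + p.1)) := by
  have h0 : ∀ p : ℕ × ℕ, 0 ≤ t ^ p.1 * u (p.2 + (1 + p.1)) := fun p =>
    mul_nonneg (pow_nonneg ht0 _) (hu0 _)
  refine (summable_prod_of_nonneg h0).2
    ⟨fun j => ((summable_nat_add_iff (1 + j)).2 hu).mul_left (t ^ j), ?_⟩
  refine Summable.of_nonneg_of_le (fun j => tsum_nonneg fun n => h0 (j, n)) (fun j => ?_)
    ((summable_geometric_of_lt_one ht0 ht1).mul_right (∑' n, u n))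
  simp only [tsum_mul_left]
  exact mul_le_mul_of_nonneg_left
    (tsum_comp_le_tsum_of_inj hu hu0 (add_left_injective (1 + j))) (pow_nonneg ht0 j)

/-- If `f ∈ ℛ_k` and `|z| < 1` then the difference quotient of `f` at `z` belongs to `ℛ_k`. -/
theorem summable_quotient
    (hgrowth : ∀ r : ℝ, 1 < r → ∃ K : ℝ, 0 ≤ K ∧ ∀ n m, (k (n + m) : ℝ) ≤ K * r ^ n * k m)
    (f : RSpace k) {z : ℂ} (hz : ‖z‖ < 1) :
    Summable fun n => ‖∑' j, f (n + 1 + j) * z ^ j‖ ^ 2 *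
      (((k n)⁻¹ : {x : ℝ // 0 < x}) : ℝ) := by
  set s := ‖z‖ with hs
  have hs0 : 0 ≤ s := norm_nonneg z
  obtain ⟨r, hr1, hr2⟩ : ∃ r : ℝ, 1 < r ∧ r * s < 1 := by
    have : Tendsto (fun r : ℝ => r * s) (𝓝[>] 1) (𝓝 (1 * s)) :=
      ((continuous_id.mul continuous_const).tendsto 1).mono_left nhdsWithin_le_nhds
    have h1 : 1 * s < 1 := by linarith
    obtain ⟨r, h, h'⟩ := ((this.eventually (gt_mem_nhds h1)).and self_mem_nhdsWithin).exists
    exact ⟨r, h', h⟩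
  have hr0 : 0 < r := by linarith
  obtain ⟨K, hK, hKk⟩ := hgrowth r hr1
  -- The factor `r ^ j` lost in moving the weight from index `n` to `n + 1 + j` is absorbed by `s ^
  -- j`, as `r * s < 1`.
  have hinv : ∀ n j, (k n : ℝ)⁻¹ ≤ K * r ^ (1 + j) * (k (n + 1 + j) : ℝ)⁻¹ := fun n j => by
    rw [← div_eq_mul_inv, le_div_iff₀ (k _).2, inv_mul_le_iff₀ (k n).2]
    have := hKk (1 + j) n
    rw [show n + 1 + j = 1 + j + n by ring]
    linarith
  have hf2 : ∀ n j, s ^ j * ‖f (n + 1 + j)‖ ^ 2 * (k n : ℝ)⁻¹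
      ≤ K * r * (r * s) ^ j * (‖f (n + (1 + j))‖ ^ 2 * (k (n + (1 + j)) : ℝ)⁻¹) := fun n j => by
    have := mul_le_mul_of_nonneg_left (hinv n j)
      (mul_nonneg (pow_nonneg hs0 j) (sq_nonneg ‖f (n + 1 + j)‖))
    refine this.trans_eq ?_
    rw [add_assoc, mul_pow, pow_add]
    ring
  have hprod := (Equiv.prodComm ℕ ℕ).summable_iff.2 ((summable_geometric_mul_shift
    (u := fun n => ‖f n‖ ^ 2 * (k n : ℝ)⁻¹)
    (fun n => mul_nonneg (sq_nonneg _) (inv_nonneg.2 (k n).2.le)) f.summable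
    (mul_nonneg hr0.le hs0) hr2).mul_left (K * r))
  have hF : Summable fun p : ℕ × ℕ => s ^ p.2 * ‖f (p.1 + 1 + p.2)‖ ^ 2 * (k p.1 : ℝ)⁻¹ :=
    Summable.of_nonneg_of_le
      (fun p => mul_nonneg (by positivity) (inv_nonneg.2 (k p.1).2.le))
      (fun p => (hf2 p.1 p.2).trans_eq (mul_assoc _ _ _)) hprod
  refine Summable.of_nonneg_of_le
    (fun n => mul_nonneg (sq_nonneg _) ((k n)⁻¹).2.le) (fun n => ?_)
    (((summable_prod_of_nonneg fun p => mul_nonneg (by positivity)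
      (inv_nonneg.2 (k p.1).2.le)).1 hF).2.mul_left (∑' j, s ^ j))
  simp only
  have hw : Summable fun j => s ^ j * ‖f (n + 1 + j)‖ ^ 2 := by
    have h := hF.prod_factor n
    simp only at h
    exact (summable_mul_right_iff (inv_ne_zero (k n).2.ne')).1 h
  rw [tsum_mul_right, ← mul_assoc, Positive.coe_inv]
  refine mul_le_mul_of_nonneg_right ?_ (inv_nonneg.2 (k n).2.le)
  have hg := summable_geometric_of_lt_one hs0 hz
  -- Cauchy–Schwarz after splitting `s ^ j` evenly between the two factors.
  have hfin : ∀ t : Finset ℕ, ‖∑ j ∈ t, f (n + 1 + j) * z ^ j‖ ^ 2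
      ≤ (∑' j, s ^ j) * ∑' j, s ^ j * ‖f (n + 1 + j)‖ ^ 2 := fun t => by
    have h1 : ‖∑ j ∈ t, f (n + 1 + j) * z ^ j‖ ≤ ∑ j ∈ t, s ^ j * ‖f (n + 1 + j)‖ :=
      (norm_sum_le _ _).trans_eq
        (Finset.sum_congr rfl fun j _ => by rw [norm_mul, norm_pow, mul_comm])
    refine (pow_le_pow_left₀ (norm_nonneg _) h1 2).trans ?_
    refine (Finset.sum_sq_le_sum_mul_sum_of_sq_le_mul t (f := fun j => s ^ j)
      (g := fun j => s ^ j * ‖f (n + 1 + j)‖ ^ 2) (fun j _ => by positivity)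
      (fun j _ => by positivity) fun j _ => le_of_eq (by ring)).trans ?_
    have h2 := hg.sum_le_tsum t fun j _ => by positivity
    have h3 := hw.sum_le_tsum t fun j _ => by positivity
    gcongr
  -- A divergent series would have `tsum` equal to `0`, for which the bound is trivial.
  by_cases hsum : Summable fun j => f (n + 1 + j) * z ^ j
  · exact le_of_tendsto (hsum.hasSum.norm.pow 2) (Eventually.of_forall hfin)
  · simpa [tsum_eq_zero_of_not_summable hsum] using hfin ∅

/-- The quotient has coefficients `qₙ = ∑ⱼ f (n + 1 + j) zʲ`. Splitting off the first term of such a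
sum gives `qₙ = f (n + 1) + z q (n + 1)`, which is the identity coefficient by coefficient. -/
theorem exists_eq_algebraMap_add_mul {hk : IsBanachAlgebra k}
    (hgrowth : ∀ r : ℝ, 1 < r → ∃ K : ℝ, 0 ≤ K ∧ ∀ n m, (k (n + m) : ℝ) ≤ K * r ^ n * k m)
    (f : algebra hk) {z : ℂ} (hz : ‖z‖ < 1) :
    ∃ h : algebra hk, f = algebraMap ℂ _ (∑' n, f.1.coeff n * z ^ n) +
      (⟨PowerSeries.X, X_mem_algebra hk⟩ - algebraMap ℂ _ z) * h := by
  let q : PowerSeries ℂ := PowerSeries.mk fun n => ∑' j, f.1.coeff (n + 1 + j) * z ^ j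
  have hq : q ∈ algebra hk := by
    have := summable_quotient hgrowth (toSeries f) hz
    simp only [toSeries_apply] at this
    simpa [algebra, q] using this
  have hs : Summable fun n => f.1.coeff n * z ^ n :=
    Summable.of_norm (by
      simpa [norm_mul, norm_pow, toSeries_apply] using summable_mul_pow hgrowth (toSeries f) hz)
  have hrec : ∀ n, Summable (fun j => f.1.coeff (n + j) * z ^ j) ∧
      ∑' j, f.1.coeff (n + j) * z ^ j
        = f.1.coeff n + z * ∑' j, f.1.coeff (n + 1 + j) * z ^ j := by
    have hstep : ∀ n, Summable (fun j => f.1.coeff (n + j) * z ^ j) →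
        ∑' j, f.1.coeff (n + j) * z ^ j
          = f.1.coeff n + z * ∑' j, f.1.coeff (n + 1 + j) * z ^ j := fun n hn => by
      rw [hn.tsum_eq_zero_add, ← tsum_mul_left]
      simp only [add_zero, pow_zero, mul_one]
      congr 1
      refine tsum_congr fun j => ?_
      rw [show n + (j + 1) = n + 1 + j by ring]
      ring
    have hsum : ∀ n, Summable (fun j => f.1.coeff (n + j) * z ^ j) := fun n => by
      -- For `z ≠ 0` the series is a tail of `f(z)` divided by `z ^ n`; for `z = 0` only the term `j
      -- = 0` survives.
      by_cases hz0 : z = 0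
      · refine summable_of_ne_finset_zero (s := {0}) fun j hj => ?_
        have : j ≠ 0 := by simpa using hj
        simp [hz0, this]
      · refine (summable_mul_right_iff (pow_ne_zero n hz0)).1 ?_
        refine ((summable_nat_add_iff n).2 hs).congr fun j => ?_
        rw [add_comm j n, pow_add]
        ring
    exact fun n => ⟨hsum n, hstep n (hsum n)⟩
  refine ⟨⟨q, hq⟩, Subtype.ext (PowerSeries.ext fun n => ?_)⟩
  have hval : (algebraMap ℂ (algebra hk) z : PowerSeries ℂ) = PowerSeries.C z := rfl
  have hval' : (algebraMap ℂ (algebra hk) (∑' n, f.1.coeff n * z ^ n) : PowerSeries ℂ)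
    = PowerSeries.C (∑' n, f.1.coeff n * z ^ n) := rfl
  simp only [AddMemClass.coe_add, MulMemClass.coe_mul, AddSubgroupClass.coe_sub, hval, hval',
    sub_mul, map_add, map_sub, PowerSeries.coeff_C_mul]
  cases n with
  | zero =>
    have := (hrec 0).2
    simp only [zero_add] at this
    simp [q, this]
  | succ n =>
    rw [PowerSeries.coeff_succ_X_mul, PowerSeries.coeff_C, if_neg n.succ_ne_zero]
    simp only [q, PowerSeries.coeff_mk, (hrec (n + 1)).2]
    ring

end RSpace

/-! ### Cramer's rule, eigenvectors and the annihilating determinant -/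

/-- Apply the adjugate to the system `G v = 0` and use `adj(G) G = det(G)`. -/
theorem Matrix.map_det_apply_eq_zero {A M ι : Type*} [CommRing A] [AddCommGroup M] [Module ℂ M]
    [Fintype ι] [DecidableEq ι] (ρ : A →+* Module.End ℂ M) (G : Matrix ι ι A) (v : ι → M)
    (h : ∀ i, ∑ j, ρ (G i j) (v j) = 0) (j : ι) : ρ G.det (v j) = 0 := by
  have h1 : ∑ i, ρ (G.adjugate j i) (∑ l, ρ (G i l) (v l)) = ρ G.det (v j) := by
    simp only [map_sum]
    rw [Finset.sum_comm]
    have h2 : ∀ l, ∑ i, ρ (G.adjugate j i) (ρ (G i l) (v l)) = ρ ((G.adjugate * G) j l) (v l) := by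
      intro l
      rw [Matrix.mul_apply, map_sum, LinearMap.sum_apply]
      exact Finset.sum_congr rfl fun i _ => by rw [map_mul]; rfl
    rw [Finset.sum_congr rfl fun l _ => h2 l, Matrix.adjugate_mul,
      Finset.sum_eq_single j]
    · simp
    · intro l _ hl
      simp [Matrix.one_apply_ne' hl]
    · simp
  rw [← h1]
  exact Finset.sum_eq_zero fun i _ => by rw [h i, map_zero]

namespace WeightedSeries

variable {k : PosWeight} {E : Type*} [NormedAddCommGroup E] [InnerProductSpace ℂ E]

/-- The scalar series of the coordinates `⟨e, xₙ⟩`. -/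
noncomputable def coord (e : E) (x : WeightedSeries k E) : WeightedSeries k ℂ :=
  mk (fun n => inner ℂ e (x n)) (by
    refine Summable.of_nonneg_of_le (fun n => mul_nonneg (sq_nonneg _) (k n).2.le) (fun n => ?_)
      (x.summable.mul_left (‖e‖ ^ 2))
    rw [← mul_assoc, ← mul_pow]
    exact mul_le_mul_of_nonneg_right
      (pow_le_pow_left₀ (norm_nonneg _) (norm_inner_le_norm e (x n)) 2) (k n).2.le)

theorem coord_apply (e : E) (x : WeightedSeries k E) (n : ℕ) : coord e x n = inner ℂ e (x n) := rfl

/-- The eigenvector `∑ zⁿ e tⁿ` of the backward shift, for `|z| < 1`. -/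
noncomputable def eigenvector
    (hgrowth : ∀ r : ℝ, 1 < r → ∃ K : ℝ, 0 ≤ K ∧ ∀ n m, (k (n + m) : ℝ) ≤ K * r ^ n * k m)
    {z : ℂ} (hz : ‖z‖ < 1) (e : E) : WeightedSeries k E :=
  mk (fun n => z ^ n • e) (RSpace.summable_eigenvector hgrowth hz e)

theorem eigenvector_apply
    (hgrowth : ∀ r : ℝ, 1 < r → ∃ K : ℝ, 0 ≤ K ∧ ∀ n m, (k (n + m) : ℝ) ≤ K * r ^ n * k m)
    {z : ℂ} (hz : ‖z‖ < 1) (e : E) (n : ℕ) : eigenvector hgrowth hz e n = z ^ n • e := rfl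

theorem backwardShift_eigenvector
    (hgrowth : ∀ r : ℝ, 1 < r → ∃ K : ℝ, 0 ≤ K ∧ ∀ n m, (k (n + m) : ℝ) ≤ K * r ^ n * k m)
    (hw : ∃ C : ℝ, ∀ n, (k n : ℝ) ≤ C * (k (n + 1) : ℝ)) {z : ℂ} (hz : ‖z‖ < 1) (e : E) :
    backwardShift k E hw (eigenvector hgrowth hz e) = z • eigenvector hgrowth hz e := by
  refine WeightedSeries.ext fun n => ?_
  rw [backwardShift_apply, coeff_smul, eigenvector_apply, eigenvector_apply, pow_succ', mul_smul]

end WeightedSeries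

namespace RSpace

variable {k : PosWeight} {E : Type*} [NormedAddCommGroup E] [InnerProductSpace ℂ E]

/-- The eigenvalue is `φ(z)`, read off from the zeroth coefficient. Evaluation at `z` is therefore
multiplicative because the action is. -/
theorem act_eigenvector {hk : IsBanachAlgebra k}
    (hgrowth : ∀ r : ℝ, 1 < r → ∃ K : ℝ, 0 ≤ K ∧ ∀ n m, (k (n + m) : ℝ) ≤ K * r ^ n * k m)
    {z : ℂ} (hz : ‖z‖ < 1) (φ : algebra hk) :
    act hk ℂ φ (eigenvector hgrowth hz 1) =
      act hk ℂ φ (eigenvector hgrowth hz 1) 0 • eigenvector hgrowth hz 1 := by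
  refine WeightedSeries.ext fun m => ?_
  rw [coeff_smul, act_apply, act_apply, eigenvector_apply, smul_eq_mul, ← tsum_mul_right]
  refine tsum_congr fun n => ?_
  rw [eigenvector_apply, eigenvector_apply]
  simp only [smul_eq_mul, add_zero, mul_one, pow_add, mul_assoc]

/-- The evaluation of the functions in `ℛ_k` at a point of the open unit disc. -/
noncomputable def eval (hk : IsBanachAlgebra k)
    (hgrowth : ∀ r : ℝ, 1 < r → ∃ K : ℝ, 0 ≤ K ∧ ∀ n m, (k (n + m) : ℝ) ≤ K * r ^ n * k m)
    {z : ℂ} (hz : ‖z‖ < 1) : algebra hk →+* ℂ where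
  toFun φ := act hk ℂ φ (eigenvector hgrowth hz 1) 0
  map_one' := by
    rw [map_one, Module.End.one_apply, eigenvector_apply]
    simp
  map_mul' φ ψ := by
    rw [map_mul, Module.End.mul_apply, act_eigenvector hgrowth hz ψ, map_smul, coeff_smul,
      smul_eq_mul, mul_comm]
    congr 2
    rw [coeff_smul, eigenvector_apply]
    simp
  map_zero' := by rw [map_zero]; rfl
  map_add' φ ψ := by rw [map_add]; rfl

theorem eval_apply (hk : IsBanachAlgebra k)
    (hgrowth : ∀ r : ℝ, 1 < r → ∃ K : ℝ, 0 ≤ K ∧ ∀ n m, (k (n + m) : ℝ) ≤ K * r ^ n * k m)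
    {z : ℂ} (hz : ‖z‖ < 1) (φ : algebra hk) :
    eval hk hgrowth hz φ = ∑' n, φ.1.coeff n * z ^ n := by
  refine tsum_congr fun n => ?_
  rw [eigenvector_apply]
  simp

/-- The series `∑ kₙ ⟨yₙ, e⟩ zⁿ`, as an element of the algebra `ℛ_k`. -/
noncomputable def dualCoord (hk : IsBanachAlgebra k) (y : WeightedSeries k E) (e : E) :
    algebra hk :=
  ⟨PowerSeries.mk fun n => ((k n : ℝ) : ℂ) * inner ℂ (y n) e, by
    have h : Summable fun n => ‖((k n : ℝ) : ℂ) * inner ℂ (y n) e‖ ^ 2 *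
        (((k n)⁻¹ : {x : ℝ // 0 < x}) : ℝ) := by
      refine Summable.of_nonneg_of_le (fun n => mul_nonneg (sq_nonneg _) ((k n)⁻¹).2.le)
        (fun n => ?_) (y.dual.summable.mul_left (‖e‖ ^ 2))
      rw [← mul_assoc, ← mul_pow, norm_dual_apply]
      refine mul_le_mul_of_nonneg_right (pow_le_pow_left₀ (norm_nonneg _) ?_ 2) ((k n)⁻¹).2.le
      have h0 := (k n).2.le
      rw [norm_mul, Complex.norm_real, Real.norm_of_nonneg h0, mul_comm ‖e‖, mul_assoc]
      exact mul_le_mul_of_nonneg_left (norm_inner_le_norm (y n) e) h0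
    simpa [algebra] using h⟩

theorem coeff_dualCoord (hk : IsBanachAlgebra k) (y : WeightedSeries k E) (e : E) (n : ℕ) :
    (dualCoord hk y e).1.coeff n = ((k n : ℝ) : ℂ) * inner ℂ (y n) e :=
  PowerSeries.coeff_mk n fun n => ((k n : ℝ) : ℂ) * inner ℂ (y n) e

theorem eval_dualCoord (hk : IsBanachAlgebra k)
    (hgrowth : ∀ r : ℝ, 1 < r → ∃ K : ℝ, 0 ≤ K ∧ ∀ n m, (k (n + m) : ℝ) ≤ K * r ^ n * k m)
    {z : ℂ} (hz : ‖z‖ < 1) (y : WeightedSeries k E) (e : E) :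
    eval hk hgrowth hz (dualCoord hk y e) = inner ℂ y (eigenvector hgrowth hz e) := by
  rw [eval_apply, inner_eq]
  refine tsum_congr fun n => ?_
  rw [coeff_dualCoord, eigenvector_apply, inner_smul_right]
  ring

/-- By Parseval in `E`, the `m`-th coefficient of the sum is `⟨y, Bᵐ x⟩`, and `Bᵐ x` stays in `L`.
-/
theorem sum_act_dualCoord {ι : Type*} [Fintype ι] (hk : IsBanachAlgebra k)
    (b : OrthonormalBasis ι ℂ E) (L : Submodule ℂ (WeightedSeries k E))
    (hL : ∀ x ∈ L, backwardShift k E hk.exists_bound x ∈ L)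
    {x y : WeightedSeries k E} (hx : x ∈ L) (hy : y ∈ Lᗮ) :
    ∑ j, act hk ℂ (dualCoord hk y (b j)) (coord (b j) x) = 0 := by
  refine WeightedSeries.ext fun m => ?_
  have h := Submodule.inner_left_of_mem_orthogonal
    (backwardShift_pow_mem hk.exists_bound L hL hx m) hy
  rw [coeff_sum]
  refine Eq.trans ?_ h
  refine (Summable.tsum_finsetSum (f := fun j n =>
    (dualCoord hk y (b j)).1.coeff n • coord (b j) x (n + m)) fun j _ =>
    hk.summable_smul_shift (toSeries (dualCoord hk y (b j))) (coord (b j) x) m).symm.trans ?_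
  refine tsum_congr fun n => ?_
  rw [backwardShift_pow_apply, ← b.sum_inner_mul_inner, Finset.mul_sum]
  refine Finset.sum_congr rfl fun j _ => ?_
  rw [coeff_dualCoord, coord_apply, smul_eq_mul, mul_assoc]

theorem coord_act [CompleteSpace E] {hk : IsBanachAlgebra k} (φ : algebra hk) (e : E)
    (x : WeightedSeries k E) : coord e (act hk E φ x) = act hk ℂ φ (coord e x) := by
  refine WeightedSeries.ext fun m => ?_
  rw [coord_apply, act_apply, act_apply]
  refine ((innerSL ℂ e).map_tsum (hk.summable_smul_shift (toSeries φ) x m)).trans ?_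
  exact tsum_congr fun n => inner_smul_right _ _ _

theorem act_det_dualCoord [CompleteSpace E] {ι : Type*} [Fintype ι] [DecidableEq ι]
    (hk : IsBanachAlgebra k)
    (b : OrthonormalBasis ι ℂ E) (L : Submodule ℂ (WeightedSeries k E))
    (hL : ∀ x ∈ L, backwardShift k E hk.exists_bound x ∈ L)
    {x : WeightedSeries k E} (hx : x ∈ L) (y : ι → WeightedSeries k E) (hy : ∀ i, y i ∈ Lᗮ) :
    act hk E (Matrix.of fun i j => dualCoord hk (y i) (b j)).det x = 0 := by
  have h := Matrix.map_det_apply_eq_zero (act hk ℂ).toRingHom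
    (Matrix.of fun i j => dualCoord hk (y i) (b j)) (fun j => coord (b j) x)
    fun i => sum_act_dualCoord hk b L hL hx (hy i)
  refine WeightedSeries.ext fun m => b.toBasis.ext_elem fun j => ?_
  have h1 : coord (b j) (act hk E (Matrix.of fun i j => dualCoord hk (y i) (b j)).det x) m = 0 := by
    rw [coord_act]
    exact congrArg (fun u : WeightedSeries k ℂ => u m) (h j)
  rw [OrthonormalBasis.coe_toBasis_repr_apply, OrthonormalBasis.coe_toBasis_repr_apply,
    OrthonormalBasis.repr_apply_apply, OrthonormalBasis.repr_apply_apply]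
  refine h1.trans (inner_zero_right _).symm

/-- If an invariant subspace of `B_k ⊗ I_E`, with `E` finite dimensional, contains no eigenvector for
some `z` in the open unit disc, then it is annihilated by some `f(B_k ⊗ I_E)` with `f ≠ 0`. -/
theorem exists_annihilator [FiniteDimensional ℂ E] [CompleteSpace E] (hk : IsBanachAlgebra k)
    (hgrowth : ∀ r : ℝ, 1 < r → ∃ K : ℝ, 0 ≤ K ∧ ∀ n m, (k (n + m) : ℝ) ≤ K * r ^ n * k m)
    (L : Submodule ℂ (WeightedSeries k E)) [L.HasOrthogonalProjection]
    (hL : ∀ x ∈ L, backwardShift k E hk.exists_bound x ∈ L) {z : ℂ} (hz : ‖z‖ < 1)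
    (hinj : ∀ x ∈ L, backwardShift k E hk.exists_bound x = z • x → x = 0) :
    ∃ f : algebra hk, f ≠ 0 ∧ ∀ x ∈ L, act hk E f x = 0 := by
  let b := stdOrthonormalBasis ℂ E
  let ε : E → WeightedSeries k E := eigenvector hgrowth hz
  let y : Fin (Module.finrank ℂ E) → WeightedSeries k E := fun i => Lᗮ.starProjection (ε (b i))
  have hy : ∀ i, y i ∈ Lᗮ := fun i => Lᗮ.starProjection_apply_mem _
  refine ⟨(Matrix.of fun i j => dualCoord hk (y i) (b j)).det, fun h0 => ?_,
    fun x hx => act_det_dualCoord hk b L hL hx y hy⟩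
  -- If the determinant were zero, its matrix at `z`, with entries `⟨y i, ε (b j)⟩`, would have a
  -- nonzero kernel vector `c`.
  have h1 := congrArg (eval hk hgrowth hz) h0
  rw [map_zero, RingHom.map_det] at h1
  obtain ⟨c, hc0, hc⟩ := Matrix.exists_mulVec_eq_zero_iff.2 h1
  have hεsum : ε (∑ j, c j • b j) = ∑ j, c j • ε (b j) := by
    refine WeightedSeries.ext fun n => ?_
    rw [coeff_sum, eigenvector_apply, Finset.smul_sum]
    exact Finset.sum_congr rfl fun j _ => smul_comm _ _ _
  have hrow : ∀ i, inner ℂ (y i) (ε (∑ j, c j • b j)) = 0 := fun i => by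
    rw [hεsum, inner_sum]
    refine Eq.trans ?_ (congrFun hc i)
    refine Finset.sum_congr rfl fun j _ => ?_
    rw [inner_smul_right, mul_comm]
    congr 1
    exact (eval_dualCoord hk hgrowth hz (y i) (b j)).symm
  -- The squared norm of this projection is a combination of the inner products in `hrow`. Its
  -- vanishing puts the eigenvector in `L`, where `hinj` kills it.
  have hproj : Lᗮ.starProjection (ε (∑ j, c j • b j)) = 0 := by
    have hsum : Lᗮ.starProjection (ε (∑ j, c j • b j)) = ∑ j, c j • y j := by
      simp only [hεsum, map_sum, map_smul, y]
    rw [← inner_self_eq_zero (𝕜 := ℂ), ← Submodule.inner_starProjection_left_eq_right,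
      Submodule.starProjection_eq_self_iff.2 (Lᗮ.starProjection_apply_mem _), hsum, sum_inner]
    exact Finset.sum_eq_zero fun i _ => by rw [inner_smul_left, hrow i, mul_zero]
  have hmem : ε (∑ j, c j • b j) ∈ L := by
    rw [Submodule.starProjection_orthogonal] at hproj
    exact Submodule.starProjection_eq_self_iff.1 (sub_eq_zero.1 hproj).symm
  have hzero := hinj _ hmem (backwardShift_eigenvector hgrowth _ hz _)
  have h2 : ∑ j, c j • b j = 0 := by
    have h3 := congrArg (fun u : WeightedSeries k E => u 0) hzero
    have h4 : ε (∑ j, c j • b j) 0 = ∑ j, c j • b j := by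
      rw [eigenvector_apply, pow_zero, one_smul]
    exact h4.symm.trans h3
  exact hc0 (funext fun j => Fintype.linearIndependent_iff.1 b.orthonormal.linearIndependent c h2 j)

/-! ### Inverting `B - z` on the subspace, and the spectrum of `T` -/

/-- If `f(B_k ⊗ I_E)` annihilates a closed invariant subspace and `f(z) ≠ 0`, then
`B_k ⊗ I_E - z` is invertible on this subspace. -/
theorem bijOn_backwardShift_sub [CompleteSpace E] {hk : IsBanachAlgebra k}
    (hgrowth : ∀ r : ℝ, 1 < r → ∃ K : ℝ, 0 ≤ K ∧ ∀ n m, (k (n + m) : ℝ) ≤ K * r ^ n * k m)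
    (L : Submodule ℂ (WeightedSeries k E)) [L.HasOrthogonalProjection]
    (hL : ∀ x ∈ L, backwardShift k E hk.exists_bound x ∈ L) (f : algebra hk)
    (hf : ∀ x ∈ L, act hk E f x = 0) {z : ℂ} (hz : ‖z‖ < 1)
    (hfz : ∑' n, f.1.coeff n * z ^ n ≠ 0) :
    (∀ x ∈ L, backwardShift k E hk.exists_bound x = z • x → x = 0) ∧
      ∀ x ∈ L, ∃ u ∈ L, backwardShift k E hk.exists_bound u - z • u = x := by
  obtain ⟨h, hh⟩ := exists_eq_algebraMap_add_mul hgrowth f hz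
  set c := ∑' n, f.1.coeff n * z ^ n
  set X : algebra hk := ⟨PowerSeries.X, X_mem_algebra hk⟩
  have hB : ∀ x : WeightedSeries k E, act hk E (X - algebraMap ℂ _ z) x
      = backwardShift k E hk.exists_bound x - z • x := fun x => by
    rw [map_sub, LinearMap.sub_apply, act_X, AlgHom.commutes, Module.algebraMap_end_apply]
  have hfX := congrArg (act hk E) hh
  -- On `L` this reads `c x = -(B - z) h(B) x`. It gives surjectivity of `B - z` directly, and
  -- injectivity after commuting the two factors.
  have hf1 : ∀ x ∈ L, c • x + act hk E (X - algebraMap ℂ _ z) (act hk E h x) = 0 := fun x hx => by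
    rw [← Module.End.mul_apply, ← map_mul, ← hf x hx, hfX, map_add, LinearMap.add_apply, AlgHom.commutes, Module.algebraMap_end_apply]
  refine ⟨fun x hx hxz => ?_,
    fun x hx => ⟨-c⁻¹ • act hk E h x, L.smul_mem _ (act_mem h L hL hx), ?_⟩⟩
  · have h1 := hf1 x hx
    rw [← Module.End.mul_apply, ← map_mul, mul_comm, map_mul, Module.End.mul_apply, hB, hxz,
      sub_self, map_zero, add_zero] at h1
    exact (smul_eq_zero.1 h1).resolve_left hfz
  · have h1 := eq_neg_of_add_eq_zero_right (hf1 x hx)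
    rw [← hB, map_smul, h1, neg_smul, smul_neg, neg_neg, inv_smul_smul₀ hfz]

end RSpace

theorem theorem5p1 (α : ℕ → ℝ) (k : PosWeight) (hk : IsReciprocalPair α k)
    (halg : RSpace.IsBanachAlgebra k)
    (hr : Tendsto (fun n : ℕ => (⨅ j : ℕ, (k j : ℝ) / (k (n + j) : ℝ)) ^ (1 / (n : ℝ)))
      atTop (𝓝 1))
    (hroot : Tendsto (fun n : ℕ => (k n : ℝ) ^ (1 / (n : ℝ))) atTop (𝓝 1))
    {D : Type*} [NormedAddCommGroup D] [InnerProductSpace ℂ D] [FiniteDimensional ℂ D]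
    {H : Type*} [NormedAddCommGroup H] [InnerProductSpace ℂ H] [CompleteSpace H]
    (T : H →L[ℂ] H)
    (hT : IsSimilarToPart T (backwardShift k D halg.exists_bound))
    (hσ : ¬ Metric.ball (0 : ℂ) 1 ⊆ spectrum ℂ T) :
    ∃ f : RSpace k, f ≠ 0 ∧ spectrum ℂ T ∩ Metric.ball (0 : ℂ) 1 ⊆ RSpace.zeroSet f := by
  have : CompleteSpace D := FiniteDimensional.complete ℂ D
  have hgrowth : ∀ r : ℝ, 1 < r → ∃ K : ℝ, 0 ≤ K ∧ ∀ n m, (k (n + m) : ℝ) ≤ K * r ^ n * k m :=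
    fun r => halg.exists_growth_bound hr
  obtain ⟨L, -, hL, S, hS⟩ := hT
  -- Completeness is carried over from `H` by `S`; it provides the orthogonal projection onto `L`.
  have : CompleteSpace L :=
    (completeSpace_congr (e := S.toEquiv) S.isUniformEmbedding).1 inferInstance
  obtain ⟨z, hz, hzσ⟩ := Set.not_subset.1 hσ
  rw [mem_ball_zero_iff] at hz
  rw [spectrum.notMem_iff, ContinuousLinearMap.isUnit_iff_bijective] at hzσ
  obtain ⟨f, hf0, hf⟩ := RSpace.exists_annihilator halg hgrowth L hL hz fun x hx hxz => by
    have h1 : T (S.symm ⟨x, hx⟩) = z • S.symm ⟨x, hx⟩ := by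
      refine S.injective (Subtype.ext ?_)
      rw [hS, map_smul, S.apply_symm_apply]
      exact hxz
    have h2 : S.symm ⟨x, hx⟩ = 0 := hzσ.1 (by
      simp [h1, Algebra.algebraMap_eq_smul_one])
    have h3 : (⟨x, hx⟩ : L) = 0 := by rw [← S.apply_symm_apply ⟨x, hx⟩, h2, map_zero]
    exact congrArg Subtype.val h3
  refine ⟨RSpace.toSeries f, fun h0 => hf0 (Subtype.ext (PowerSeries.ext fun n => ?_)), ?_⟩
  · exact congrArg (fun u : RSpace k => u n) h0
  rintro w ⟨hwσ, hw⟩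
  rw [mem_ball_zero_iff] at hw
  have hsum : Summable fun n => RSpace.toSeries f n * w ^ n :=
    Summable.of_norm (by
      simpa [norm_mul, norm_pow] using RSpace.summable_mul_pow hgrowth (RSpace.toSeries f) hw)
  refine ⟨hw, ?_⟩
  by_contra hne
  have hfw : ∑' n, f.1.coeff n * w ^ n ≠ 0 := fun h => hne (h ▸ hsum.hasSum)
  obtain ⟨hinj, hsurj⟩ := RSpace.bijOn_backwardShift_sub hgrowth L hL f hf hw hfw
  refine spectrum.mem_iff.1 hwσ (ContinuousLinearMap.isUnit_iff_bijective.2 ⟨?_, fun v => ?_⟩)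
  · refine (injective_iff_map_eq_zero _).2 fun v hv => ?_
    have h1 : T v = w • v := by
      rw [sub_apply, Algebra.algebraMap_eq_smul_one] at hv
      exact (sub_eq_zero.1 hv).symm
    have h2 := hinj (S v) (S v).2 (by rw [← hS, h1, map_smul]; rfl)
    exact (map_eq_zero_iff S S.injective).1 (Subtype.ext h2)
  -- The spectrum is defined through `w - T`, while `hsurj` solves for `B - w`; hence the sign.
  · obtain ⟨u, hu, huv⟩ := hsurj (S (-v)) (S (-v)).2
    refine ⟨S.symm ⟨u, hu⟩, S.injective (Subtype.ext ?_)⟩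
    have h1 : S (T (S.symm ⟨u, hu⟩)) - w • ⟨u, hu⟩ = S (-v) := Subtype.ext (by
      rw [← huv, AddSubgroupClass.coe_sub, hS, S.apply_symm_apply]
      rfl)
    rw [sub_apply, Algebra.algebraMap_eq_smul_one]
    have h2 : S (w • S.symm ⟨u, hu⟩ - T (S.symm ⟨u, hu⟩)) = S v := by
      rw [map_sub, map_smul, S.apply_symm_apply, ← neg_sub, h1, map_neg, neg_neg]
    exact congrArg Subtype.val h2
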